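/- Let $n \ge 0$ and let $H < \mathrm{GL}(n,\mathbb{R})$ be a closed subgroup with left Haar measure $dh$ (any normalization). For $x \in \mathbb{R}^n$, $h \in H$ and $f, \psi \in L^2(\mathbb{R}^n)$ (complex-valued functions) put \[ (\pi(x,h)f)(y) = |\det h|^{-1/2} f(h^{-1}(y-x)), \qquad V_\psi f(x,h) = \langle f, \pi(x,h)\psi\rangle = \int_{\mathbb{R}^n} f(y)\,\overline{(\pi(x,h)\psi)(y)}\,dy . \] Endow the semidirect product $G = \mathbb{R}^n \rtimes H$ with its left Haar measure $|\det h|^{-1}\,dx\,dh$. The group $H$ is called admissible if there is $\psi \in L^2(\mathbb{R}^n)$ such that $V_\psi$ is an isometry of $L^2(\mathbb{R}^n)$ into $L^2(G)$, that is, $V_\psi f \in L^2(G)$ and $\|V_\psi f\|_{L^2(G)} = \|f\|_{L^2(\mathbb{R}^n)}$ for all $f \in L^2(\mathbb{R}^n)$. Let $H_0 \subset H_1$ be closed abelian subgroups of $\mathrm{GL}(n,\mathbb{R})$ such that the quotient $H_1/H_0$ is compact. Then $H_0$ is admissible if and only if $H_1$ is admissible. -/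

import Mathlib

open MeasureTheory Matrix
open scoped MatrixGroups

noncomputable section

namespace WaveletAdmissibility

/-- The Euclidean space `ℝⁿ`, carrying Lebesgue measure. -/
abbrev Rn (n : ℕ) : Type := EuclideanSpace ℝ (Fin n)

/-- The Hilbert space `L²(ℝⁿ)` of complex-valued functions. -/
abbrev L2 (n : ℕ) : Type := Lp ℂ 2 (volume : Measure (Rn n))

/-- A matrix group carries the Borel sets of its topology as a subgroup of `GL(n, ℝ)`. -/
instance instMeasurableSpaceMatrixGroup {n : ℕ} (H : Subgroup (GL (Fin n) ℝ)) :
    MeasurableSpace H := borel H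

instance instBorelSpaceMatrixGroup {n : ℕ} (H : Subgroup (GL (Fin n) ℝ)) : BorelSpace H := ⟨rfl⟩

/-- The determinant of an invertible matrix, as a real number. -/
def detR {n : ℕ} (h : GL (Fin n) ℝ) : ℝ := (h : Matrix (Fin n) (Fin n) ℝ).det

/-- The quasiregular representation of the affine group,
`(π(x,h) f)(y) = |det h|^{-1/2} f(h⁻¹ (y - x))`. -/
def quasiRegular {n : ℕ} (x : Rn n) (h : GL (Fin n) ℝ) (f : Rn n → ℂ) (y : Rn n) : ℂ :=
  ((|detR h| ^ (-(1 / 2 : ℝ)) : ℝ) : ℂ) *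
    f (Matrix.toEuclideanLin ((h⁻¹ : GL (Fin n) ℝ) : Matrix (Fin n) (Fin n) ℝ) (y - x))

/-- The continuous wavelet transform `V_ψ f (x,h) = ⟨f, π(x,h) ψ⟩`, a function on `ℝⁿ ⋊ H`,
whose underlying space is `ℝⁿ × H`. -/
def waveletTransform {n : ℕ} (H : Subgroup (GL (Fin n) ℝ)) (ψ f : L2 n) (p : Rn n × H) : ℂ :=
  ∫ y : Rn n, f y * (starRingEnd ℂ) (quasiRegular p.1 (p.2 : GL (Fin n) ℝ) ψ y)

/-- The left Haar measure `|det h|⁻¹ dx dh` of the semidirect product `ℝⁿ ⋊ H` that belongs to a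
left Haar measure `μ = dh` of `H`. -/
def affineHaar {n : ℕ} (H : Subgroup (GL (Fin n) ℝ)) (μ : Measure H) : Measure (Rn n × H) :=
  (volume : Measure (Rn n)).prod
    (μ.withDensity fun h => ENNReal.ofReal |detR (h : GL (Fin n) ℝ)|⁻¹)

/-- `ψ` is an admissible vector: `V_ψ` is an isometry of `L²(ℝⁿ)` into `L²(ℝⁿ ⋊ H)`. -/
def IsAdmissibleVector {n : ℕ} (H : Subgroup (GL (Fin n) ℝ)) (μ : Measure H) (ψ : L2 n) : Prop :=
  ∀ f : L2 n,
    MemLp (waveletTransform H ψ f) 2 (affineHaar H μ) ∧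
      eLpNorm (waveletTransform H ψ f) 2 (affineHaar H μ) = ‖f‖ₑ

/-- The matrix group `H`, with left Haar measure `μ`, is admissible if it has an admissible
vector. -/
def IsAdmissible {n : ℕ} (H : Subgroup (GL (Fin n) ℝ)) (μ : Measure H) : Prop :=
  ∃ ψ : L2 n, IsAdmissibleVector H μ ψ

end WaveletAdmissibility

end

/-!
Admissibility is a statement about square integrable functions on the frequency space. By Parseval's
identity, for fixed `h` the map `x ↦ V_ψ f (x, h)` is a Fourier integral of the function
`ω ↦ 𝓕 ψ (hᵀ ω) · conj (𝓕 f ω)`, up to conjugation and the factor `|det h|^{1/2}`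
(`conj_waveletTransform`). Plancherel's formula then turns the energy of `V_ψ f` into
`∫ |𝓕 f ω|² (∫_H |𝓕 ψ (hᵀ ω)|² dh) dω` (`lintegral_waveletTransform`). Hence `H` is admissible if
and only if there is an integrable density `ρ ≥ 0` on the frequency space with `∫_H ρ(hᵀ ω) dh = 1`
for almost every `ω` (`isAdmissible_iff_calderon`).

For `H₀ ≤ H₁` closed, commutative and cocompact, there is a bounded weight `w` of compact support on
`H₁` with `∫_{H₀} w(x h⁻¹) dh = 1` for all `x` (`exists_weight`), and therefore
`∫_{H₁} F = ∫_{H₁} w(x) ∫_{H₀} F(x h) dh dx` (`lintegral_eq_lintegral_weight`).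

If `ρ` satisfies the criterion for `H₀`, this formula gives
`∫_{H₁} ρ(xᵀ ω) dx = ∫_{H₁} w` almost everywhere, a positive finite constant by which `ρ` is
divided.
If `ρ` satisfies the criterion for `H₁`, the average `g(ω) = ∫_{H₁} w(x) ρ(xᵀ ω) dx` satisfies it
for `H₀`: as the two actions commute, `∫_{H₀} g(hᵀ ω) dh = ∫_{H₁} ρ(xᵀ ω) dx = 1`, and
`∫ g = ∫ ρ · ∫_{H₁} w(x) |det x|⁻¹ dx` is finite.
-/

namespace WaveletAdmissibility

/-! ### Plancherel for integrable `L²` functions, weighted composition operators -/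

section Fourier

open scoped FourierTransform ENNReal SchwartzMap

variable {E : Type*} [NormedAddCommGroup E] [InnerProductSpace ℝ E] [FiniteDimensional ℝ E]
  [MeasurableSpace E] [BorelSpace E]

theorem eLpNorm_two_sq {α : Type*} [MeasurableSpace α] (μ : Measure α) (f : α → ℂ) :
    eLpNorm f 2 μ ^ 2 = ∫⁻ a, ‖f a‖ₑ ^ 2 ∂μ := by
  have := eLpNorm_nnreal_pow_eq_lintegral (μ := μ) (f := f) (p := 2) (by norm_num)
  norm_num at this
  exact_mod_cast this

theorem eLpNorm_two_eq_iff {α β : Type*} [MeasurableSpace α] [MeasurableSpace β] {μ : Measure α}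
    {ν : Measure β} {f : α → ℂ} {g : β → ℂ} :
    eLpNorm f 2 μ = eLpNorm g 2 ν ↔ ∫⁻ a, ‖f a‖ₑ ^ 2 ∂μ = ∫⁻ b, ‖g b‖ₑ ^ 2 ∂ν := by
  rw [← eLpNorm_two_sq, ← eLpNorm_two_sq]
  exact (ENNReal.pow_right_strictMono two_ne_zero).injective.eq_iff.symm

/-- On `L¹ ∩ L²` the unitary Fourier transform is given by the Fourier integral. Both are locally
integrable functions with the same pairing against test functions, by the self-adjointness of the
Fourier integral on `L¹` on one side and of the tempered Fourier transform on the other. -/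
theorem fourier_toLp_ae_eq {g : E → ℂ} (hg₁ : Integrable g) (hg₂ : MemLp g 2) :
    (𝓕 (hg₂.toLp g) : Lp ℂ 2 (volume : Measure E)) =ᵐ[volume] 𝓕 g := by
  have hcont : Continuous (𝓕 g) :=
    VectorFourier.fourierIntegral_continuous Real.continuous_fourierChar
      (by exact continuous_inner) hg₁
  refine ae_eq_of_integral_contDiff_smul_eq ((Lp.memLp _).locallyIntegrable (by norm_num))
    hcont.locallyIntegrable fun φ hφ hφc => ?_
  have h₁ : HasCompactSupport (Complex.ofRealCLM ∘ φ) := hφc.comp_left rfl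
  have h₂ : ContDiff ℝ ((⊤ : ℕ∞) : WithTop ℕ∞) (Complex.ofRealCLM ∘ φ) := by fun_prop
  set Φ : 𝓢(E, ℂ) := h₁.toSchwartzMap h₂
  have hΦ : ∀ x, Φ x = (φ x : ℂ) := fun x => rfl
  have key := congrArg (fun T : 𝓢'(E, ℂ) => T Φ)
    (Lp.fourier_toTemperedDistribution_eq (hg₂.toLp g))
  simp only [Lp.toTemperedDistribution_apply, TemperedDistribution.fourier_apply] at key
  have hflip : ∫ x, 𝓕 (Φ : E → ℂ) x • g x = ∫ x, Φ x • 𝓕 g x := by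
    have := VectorFourier.integral_fourierIntegral_smul_eq_flip (e := Real.fourierChar)
      (μ := (volume : Measure E)) (ν := (volume : Measure E)) (L := innerₗ E)
      (f := Φ) (g := g) Real.continuous_fourierChar (by exact continuous_inner) Φ.integrable hg₁
    rw [flip_innerₗ] at this
    exact this
  calc ∫ x, φ x • (𝓕 (hg₂.toLp g) : Lp ℂ 2 (volume : Measure E)) x
      = ∫ x, Φ x • (𝓕 (hg₂.toLp g) : Lp ℂ 2 (volume : Measure E)) x := by simp [hΦ]
    _ = ∫ x, (𝓕 Φ) x • (hg₂.toLp g) x := key.symm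
    _ = ∫ x, 𝓕 (Φ : E → ℂ) x • g x := by
        refine integral_congr_ae ?_
        filter_upwards [hg₂.coeFn_toLp] with x hx
        rw [hx, SchwartzMap.fourier_coe]
    _ = ∫ x, φ x • 𝓕 g x := by rw [hflip]; simp [hΦ]

/-- Plancherel's formula for the Fourier integral on `L¹ ∩ L²`. -/
theorem lintegral_enorm_fourier_sq {g : E → ℂ} (hg₁ : Integrable g) (hg₂ : MemLp g 2) :
    ∫⁻ x, ‖𝓕 g x‖ₑ ^ 2 = ∫⁻ x, ‖g x‖ₑ ^ 2 := by
  rw [← eLpNorm_two_eq_iff, ← eLpNorm_congr_ae (fourier_toLp_ae_eq hg₁ hg₂),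
    ← eLpNorm_congr_ae hg₂.coeFn_toLp, ← Lp.enorm_def, ← Lp.enorm_def,
    ← ofReal_norm, ← ofReal_norm, Lp.norm_fourier_eq]

/-- The weighted composition `f ↦ m · (f ∘ e)` preserves the `L²` norm when `|m|²` is the constant
that compensates the dilation of the volume by `e`. -/
theorem lintegral_enorm_sq_weighted_comp {e : E → E} {m : E → ℂ} {a : ℝ≥0∞} (he : Measurable e)
    (hmap : Measure.map e volume = a • volume) (hma : ∀ y, ‖m y‖ₑ ^ 2 * a = 1)
    {f : E → ℂ} (hf : Measurable f) :
    ∫⁻ y, ‖m y * f (e y)‖ₑ ^ 2 = ∫⁻ y, ‖f y‖ₑ ^ 2 := by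
  have hc : ∀ y, ‖m y‖ₑ ^ 2 = a⁻¹ := fun y => ENNReal.eq_inv_of_mul_eq_one_left (hma y)
  have ha : a⁻¹ * a = 1 := by rw [← hc 0, hma 0]
  simp_rw [enorm_mul, mul_pow, hc]
  rw [lintegral_const_mul _ (by fun_prop)]
  have := lintegral_map (μ := (volume : Measure E)) (f := fun y => ‖f y‖ₑ ^ 2) (by fun_prop) he
  rw [← this, hmap, lintegral_smul_measure, smul_eq_mul, ← mul_assoc, ha, one_mul]

/-- A norm-preserving weighted composition, as an isometry of `L²`. -/
theorem exists_isometry_weighted_comp {e : E → E} {m : E → ℂ} {a : ℝ≥0∞} (he : Measurable e)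
    (hm : Measurable m) (hmap : Measure.map e volume = a • volume)
    (hma : ∀ y, ‖m y‖ₑ ^ 2 * a = 1) :
    ∃ T : Lp ℂ 2 (volume : Measure E) → Lp ℂ 2 (volume : Measure E), Isometry T ∧
      ∀ f, T f =ᵐ[volume] fun y => m y * f (e y) := by
  have hmeas : ∀ f : Lp ℂ 2 (volume : Measure E), Measurable f := fun f =>
    (Lp.stronglyMeasurable f).measurable
  have hmem : ∀ f : Lp ℂ 2 (volume : Measure E),
      MemLp (fun y => m y * f (e y)) 2 (volume : Measure E) := fun f => by
    refine ⟨(hm.mul ((hmeas f).comp he)).aestronglyMeasurable, ?_⟩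
    rw [eLpNorm_two_eq_iff.2 (lintegral_enorm_sq_weighted_comp he hmap hma (hmeas f))]
    exact (Lp.memLp f).2
  have hq : Measure.QuasiMeasurePreserving e (volume : Measure E) volume := by
    refine ⟨he, ?_⟩
    rw [hmap]
    exact Measure.smul_absolutelyContinuous
  refine ⟨fun f => (hmem f).toLp _, fun f g => ?_, fun f => (hmem f).coeFn_toLp⟩
  rw [Lp.edist_def, Lp.edist_def]
  have h₁ : (⇑((hmem f).toLp _) - ⇑((hmem g).toLp _) : E → ℂ) =ᵐ[volume]
      fun y => m y * (f - g : Lp ℂ 2 (volume : Measure E)) (e y) := by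
    filter_upwards [(hmem f).coeFn_toLp, (hmem g).coeFn_toLp,
      hq.ae (Lp.coeFn_sub f g)] with y h₁ h₂ h₃
    rw [Pi.sub_apply] at h₃ ⊢
    rw [h₁, h₂, h₃, mul_sub]
  rw [eLpNorm_congr_ae h₁, ← eLpNorm_congr_ae (Lp.coeFn_sub f g)]
  exact eLpNorm_two_eq_iff.2 (lintegral_enorm_sq_weighted_comp he hmap hma (hmeas _))

end Fourier

/-! ### The quasiregular representation on the frequency side -/

section Matrix

open scoped FourierTransform

variable {n : ℕ}

/-- The dual action `ω ↦ hᵀ ω` of `GL(n, ℝ)` on the frequency space. -/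
noncomputable def dualAct (h : GL (Fin n) ℝ) (ω : Rn n) : Rn n :=
  Matrix.toEuclideanLin (h : Matrix (Fin n) (Fin n) ℝ)ᵀ ω

theorem dualAct_mul (h k : GL (Fin n) ℝ) (ω : Rn n) :
    dualAct (h * k) ω = dualAct k (dualAct h ω) := by
  simp [dualAct, Matrix.toLpLin_apply, Matrix.transpose_mul, Matrix.mulVec_mulVec]

theorem continuous_dualAct : Continuous fun p : GL (Fin n) ℝ × Rn n => dualAct p.1 p.2 := by
  unfold dualAct
  simp only [Matrix.toLpLin_apply]
  refine (PiLp.continuous_toLp 2 _).comp ?_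
  exact (Continuous.matrix_transpose (Units.continuous_val.comp continuous_fst)).matrix_mulVec
    ((PiLp.continuous_ofLp 2 _).comp continuous_snd)

theorem detR_ne_zero (h : GL (Fin n) ℝ) : detR h ≠ 0 :=
  ((Matrix.isUnit_iff_isUnit_det _).1 h.isUnit).ne_zero

theorem continuous_detR : Continuous (detR : GL (Fin n) ℝ → ℝ) :=
  Continuous.matrix_det Units.continuous_val

theorem detR_inv (h : GL (Fin n) ℝ) : detR h⁻¹ = (detR h)⁻¹ := by
  have : detR h * detR h⁻¹ = 1 := by
    unfold detR
    rw [← Matrix.det_mul, ← Units.val_mul, mul_inv_cancel, Units.val_one, Matrix.det_one]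
  exact eq_inv_of_mul_eq_one_right this

theorem det_toEuclideanLin (M : Matrix (Fin n) (Fin n) ℝ) :
    LinearMap.det (Matrix.toEuclideanLin M) = M.det := by
  rw [Matrix.toEuclideanLin_eq_toLin_orthonormal, LinearMap.det_toLin]

theorem map_toEuclideanLin_volume {M : Matrix (Fin n) (Fin n) ℝ} (hM : M.det ≠ 0) :
    Measure.map (Matrix.toEuclideanLin M) (volume : Measure (Rn n)) =
      ENNReal.ofReal |M.det|⁻¹ • volume := by
  have := Measure.map_linearMap_addHaar_eq_smul_addHaar (volume : Measure (Rn n))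
    (f := Matrix.toEuclideanLin M) (by rwa [det_toEuclideanLin])
  rwa [det_toEuclideanLin, abs_inv] at this

theorem measurable_toEuclideanLin (M : Matrix (Fin n) (Fin n) ℝ) :
    Measurable (Matrix.toEuclideanLin M : Rn n → Rn n) :=
  (LinearMap.continuous_of_finiteDimensional _).measurable

theorem map_dualAct_volume (h : GL (Fin n) ℝ) :
    Measure.map (dualAct h) (volume : Measure (Rn n)) =
      ENNReal.ofReal |detR h|⁻¹ • volume := by
  have := map_toEuclideanLin_volume (M := (h : Matrix (Fin n) (Fin n) ℝ)ᵀ)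
    (by rw [Matrix.det_transpose]; exact detR_ne_zero h)
  rwa [Matrix.det_transpose] at this

theorem measurable_dualAct (h : GL (Fin n) ℝ) : Measurable (dualAct h) :=
  measurable_toEuclideanLin _

theorem quasiMeasurePreserving_dualAct (h : GL (Fin n) ℝ) :
    Measure.QuasiMeasurePreserving (dualAct h) (volume : Measure (Rn n)) volume :=
  ⟨measurable_dualAct h, by rw [map_dualAct_volume]; exact Measure.smul_absolutelyContinuous⟩

theorem measurable_affine (x : Rn n) (h : GL (Fin n) ℝ) : Measurable fun y : Rn n =>
    Matrix.toEuclideanLin ((h⁻¹ : GL (Fin n) ℝ) : Matrix (Fin n) (Fin n) ℝ) (y - x) :=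
  (measurable_toEuclideanLin _).comp (measurable_id.sub_const x)

theorem map_affine_volume (x : Rn n) (h : GL (Fin n) ℝ) :
    Measure.map (fun y : Rn n =>
      Matrix.toEuclideanLin ((h⁻¹ : GL (Fin n) ℝ) : Matrix (Fin n) (Fin n) ℝ) (y - x)) volume =
      ENNReal.ofReal |detR h| • volume := by
  have h₁ := map_toEuclideanLin_volume (detR_ne_zero h⁻¹)
  have h₂ : ((h⁻¹ : GL (Fin n) ℝ) : Matrix (Fin n) (Fin n) ℝ).det = (detR h)⁻¹ := detR_inv h
  rw [h₂, abs_inv, inv_inv] at h₁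
  rw [← h₁]
  conv_rhs => rw [← (measurePreserving_sub_right (volume : Measure (Rn n)) x).map_eq]
  exact (Measure.map_map (measurable_toEuclideanLin _) (measurable_id.sub_const x)).symm

theorem enorm_rpow_sq_mul {d s : ℝ} (hd : 0 < d) :
    ‖((d ^ (s / 2) : ℝ) : ℂ)‖ₑ ^ 2 = ENNReal.ofReal (d ^ s) := by
  rw [← ofReal_norm, Complex.norm_real, Real.norm_of_nonneg (by positivity),
    ← ENNReal.ofReal_pow (by positivity), ← Real.rpow_natCast, ← Real.rpow_mul hd.le]
  norm_num

theorem inner_toEuclideanLin (h : GL (Fin n) ℝ) (x y : Rn n) :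
    inner ℝ (Matrix.toEuclideanLin (h : Matrix (Fin n) (Fin n) ℝ) x) y =
      inner ℝ x (dualAct h y) := by
  unfold dualAct
  rw [← Matrix.conjTranspose_eq_transpose_of_trivial,
    Matrix.toEuclideanLin_conjTranspose_eq_adjoint, LinearMap.adjoint_inner_right]

/-- The function `ω ↦ |det h|^{1/2} e^{-2πi⟨x,ω⟩} φ(hᵀ ω)`; for `φ = 𝓕 f` it is the Fourier
transform of `π(x,h) f`. -/
noncomputable def dualRegular (x : Rn n) (h : GL (Fin n) ℝ) (φ : Rn n → ℂ) (ω : Rn n) : ℂ :=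
  (((|detR h| ^ (1 / 2 : ℝ) : ℝ) : ℂ) * Real.fourierChar (-inner ℝ x ω)) * φ (dualAct h ω)

/-- The Fourier integral intertwines `quasiRegular` and `dualRegular`, by the substitution
`y = h z + x`. -/
theorem fourier_quasiRegular (x : Rn n) (h : GL (Fin n) ℝ) {f : Rn n → ℂ}
    (hf : AEStronglyMeasurable f volume) (ω : Rn n) :
    𝓕 (quasiRegular x h f) ω = dualRegular x h (𝓕 f) ω := by
  have hd : 0 < |detR h| := abs_pos.2 (detR_ne_zero h)
  set e : Rn n → Rn n := fun y =>
    Matrix.toEuclideanLin ((h⁻¹ : GL (Fin n) ℝ) : Matrix (Fin n) (Fin n) ℝ) (y - x) with he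
  set B := Matrix.toEuclideanLin (h : Matrix (Fin n) (Fin n) ℝ) with hB
  have hBe : ∀ y, B (e y) + x = y := fun y => by
    simp [hB, he, Matrix.toLpLin_apply]
  set G : Rn n → ℂ := fun z => Real.fourierChar (-inner ℝ (B z + x) ω) • f z with hG
  have hBc : Continuous B := LinearMap.continuous_of_finiteDimensional _
  have hGm : AEStronglyMeasurable G volume := by
    refine AEStronglyMeasurable.smul (Continuous.aestronglyMeasurable ?_) hf
    exact continuous_subtype_val.comp (Real.continuous_fourierChar.comp
      ((hBc.add continuous_const).inner continuous_const).neg)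
  have h₁ : ∫ y, G (e y) = |detR h| • ∫ z, G z := by
    have := integral_map (μ := (volume : Measure (Rn n))) (measurable_affine x h).aemeasurable
      (f := G) (by rw [map_affine_volume]; exact hGm.smul_measure _)
    rw [← this, map_affine_volume, integral_smul_measure, ENNReal.toReal_ofReal hd.le]
  rw [Real.fourier_eq]
  have h₂ : ∀ y, Real.fourierChar (-inner ℝ y ω) • quasiRegular x h f y =
      ((|detR h| ^ (-(1 / 2 : ℝ)) : ℝ) : ℂ) * G (e y) := fun y => by
    have : quasiRegular x h f y = ((|detR h| ^ (-(1 / 2 : ℝ)) : ℝ) : ℂ) * f (e y) := rfl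
    rw [this]
    simp only [hG, hBe, Circle.smul_def, smul_eq_mul]
    ring
  have h₃ : ∀ z, G z = Real.fourierChar (-inner ℝ x ω) *
      (Real.fourierChar (-inner ℝ z (dualAct h ω)) • f z) := fun z => by
    simp only [hG, inner_add_left, hB, inner_toEuclideanLin, neg_add, AddChar.map_add_eq_mul,
      Circle.smul_def, smul_eq_mul, Circle.coe_mul]
    ring
  simp_rw [h₂]
  rw [integral_const_mul, h₁]
  simp_rw [h₃]
  rw [integral_const_mul, dualRegular, Real.fourier_eq, Complex.real_smul]
  have h₄ : |detR h| ^ (-(1 / 2 : ℝ)) * |detR h| = |detR h| ^ (1 / 2 : ℝ) := by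
    conv_lhs => rw [← Real.rpow_one |detR h|, ← Real.rpow_mul hd.le, ← Real.rpow_add hd]
    norm_num
  rw [← h₄]
  push_cast
  ring

theorem exists_isometry_quasiRegular (x : Rn n) (h : GL (Fin n) ℝ) :
    ∃ T : L2 n → L2 n, Isometry T ∧ ∀ f : L2 n, T f =ᵐ[volume] quasiRegular x h f := by
  have hd : 0 < |detR h| := abs_pos.2 (detR_ne_zero h)
  refine exists_isometry_weighted_comp (measurable_affine x h) (m := fun _ =>
    ((|detR h| ^ (-(1 / 2 : ℝ)) : ℝ) : ℂ)) measurable_const (map_affine_volume x h) fun y => ?_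
  rw [show (-(1 / 2) : ℝ) = -1 / 2 by norm_num, enorm_rpow_sq_mul hd,
    ← ENNReal.ofReal_mul (by positivity), Real.rpow_neg_one, inv_mul_cancel₀ hd.ne',
    ENNReal.ofReal_one]

theorem exists_isometry_dualRegular (x : Rn n) (h : GL (Fin n) ℝ) :
    ∃ T : L2 n → L2 n, Isometry T ∧ ∀ f : L2 n, T f =ᵐ[volume] dualRegular x h f := by
  have hd : 0 < |detR h| := abs_pos.2 (detR_ne_zero h)
  refine exists_isometry_weighted_comp (measurable_dualAct h) (m := fun ω =>
    ((|detR h| ^ (1 / 2 : ℝ) : ℝ) : ℂ) * Real.fourierChar (-inner ℝ x ω)) ?_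
    (map_dualAct_volume h) fun y => ?_
  · refine Continuous.measurable (continuous_const.mul ?_)
    exact continuous_subtype_val.comp (Real.continuous_fourierChar.comp (by fun_prop))
  · rw [enorm_mul, mul_pow, enorm_rpow_sq_mul hd, ← ofReal_norm, Circle.norm_coe,
      ENNReal.ofReal_one, one_pow, mul_one, ← ENNReal.ofReal_mul (by positivity),
      Real.rpow_one, mul_inv_cancel₀ hd.ne', ENNReal.ofReal_one]

/-- The `L²` Fourier transform intertwines `quasiRegular` and `dualRegular`: both sides depend
continuously on `ψ`, and they agree on the dense subspace of Schwartz functions. -/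
theorem fourier_eq_dualRegular (x : Rn n) (h : GL (Fin n) ℝ) (ψ g : L2 n)
    (hg : g =ᵐ[volume] quasiRegular x h ψ) :
    (𝓕 g : L2 n) =ᵐ[volume] dualRegular x h (𝓕 ψ : L2 n) := by
  obtain ⟨T, hT, hTf⟩ := exists_isometry_quasiRegular x h
  obtain ⟨S, hS, hSf⟩ := exists_isometry_dualRegular x h
  have hgT : g = T ψ := Lp.ext (hg.trans (hTf ψ).symm)
  suffices 𝓕 (T ψ) = S (𝓕 ψ) by rw [hgT, this]; exact hSf _
  have hF : Continuous (𝓕 : L2 n → L2 n) := (Lp.fourierTransformₗᵢ (Rn n) ℂ).continuous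
  refine DenseRange.induction_on (p := fun ψ : L2 n => 𝓕 (T ψ) = S (𝓕 ψ))
    (SchwartzMap.denseRange_toLpCLM (E := Rn n) (F := ℂ) (p := 2) (μ := volume)
      ENNReal.ofNat_ne_top) ψ
    (isClosed_eq (hF.comp hT.continuous) (hS.continuous.comp hF)) fun φ => ?_
  change 𝓕 (T (φ.toLp 2)) = S (𝓕 (φ.toLp 2))
  have hq : Measure.QuasiMeasurePreserving (fun y : Rn n =>
      Matrix.toEuclideanLin ((h⁻¹ : GL (Fin n) ℝ) : Matrix (Fin n) (Fin n) ℝ) (y - x)) :=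
    ⟨measurable_affine x h, by rw [map_affine_volume]; exact Measure.smul_absolutelyContinuous⟩
  have h₁ : T (φ.toLp 2) =ᵐ[volume] quasiRegular x h φ := by
    refine (hTf _).trans ?_
    filter_upwards [hq.ae (φ.coeFn_toLp 2 volume)] with y hy
    simp only [quasiRegular, hy]
  have h₂ : MemLp (quasiRegular x h φ) 2 volume := (memLp_congr_ae h₁).1 (Lp.memLp _)
  have h₃ : Integrable (quasiRegular x h φ) := by
    refine Integrable.const_mul ?_ _
    refine Integrable.comp_measurable (f := fun y : Rn n => Matrix.toEuclideanLin
      ((h⁻¹ : GL (Fin n) ℝ) : Matrix (Fin n) (Fin n) ℝ) (y - x)) ?_ (measurable_affine x h)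
    rw [map_affine_volume]
    exact φ.integrable.smul_measure ENNReal.ofReal_ne_top
  have h₄ : T (φ.toLp 2) = h₂.toLp _ := Lp.ext (h₁.trans h₂.coeFn_toLp.symm)
  rw [h₄, SchwartzMap.toLp_fourier_eq]
  refine Lp.ext ((fourier_toLp_ae_eq h₃ h₂).trans (Filter.EventuallyEq.trans ?_ (hSf _).symm))
  filter_upwards [(quasiMeasurePreserving_dualAct h).ae ((𝓕 φ).coeFn_toLp 2 volume)] with ω hω
  rw [fourier_quasiRegular x h φ.continuous.aestronglyMeasurable]
  simp only [dualRegular, hω, SchwartzMap.fourier_coe]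

end Matrix

/-! ### Calderón's criterion -/

section Calderon

open scoped FourierTransform ENNReal ComplexConjugate

variable {n : ℕ}

instance instSecondCountableTopologyGL : SecondCountableTopology (GL (Fin n) ℝ) :=
  have : SecondCountableTopology (Matrix (Fin n) (Fin n) ℝ) :=
    inferInstanceAs (SecondCountableTopology (Fin n → Fin n → ℝ))
  have : SecondCountableTopology (Matrix (Fin n) (Fin n) ℝ)ᵐᵒᵖ :=
    MulOpposite.opHomeomorph.symm.secondCountableTopology
  Units.isEmbedding_embedProduct.secondCountableTopology

instance instSecondCountableTopologyMatrixGroup (H : Subgroup (GL (Fin n) ℝ)) :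
    SecondCountableTopology H :=
  TopologicalSpace.Subtype.secondCountableTopology _

variable {H : Subgroup (GL (Fin n) ℝ)} {μ : Measure H}

/-- The Calderón integral `ω ↦ ∫_H ρ(hᵀ ω) dh`. -/
noncomputable def calderon (H : Subgroup (GL (Fin n) ℝ)) (μ : Measure H) (ρ : Rn n → ℝ≥0∞)
    (ω : Rn n) : ℝ≥0∞ :=
  ∫⁻ h : H, ρ (dualAct (h : GL (Fin n) ℝ) ω) ∂μ

theorem measurable_dualAct_prod : Measurable fun p : Rn n × H => dualAct (p.2 : GL (Fin n) ℝ) p.1 :=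
  (continuous_dualAct.comp
    ((continuous_subtype_val.comp continuous_snd).prodMk continuous_fst)).measurable

theorem measurable_dualAct_comp {α : Type*} [MeasurableSpace α] {a : α → H} {b : α → Rn n}
    (ha : Measurable a) (hb : Measurable b) :
    Measurable fun z => dualAct (a z : GL (Fin n) ℝ) (b z) := by
  have h₁ : Measurable fun z => (b z, a z) := hb.prodMk ha
  have h₂ := measurable_dualAct_prod (H := H)
  have h₃ := h₂.comp h₁
  exact h₃

theorem measurable_calderon [SFinite μ] {ρ : Rn n → ℝ≥0∞} (hρ : Measurable ρ) :
    Measurable (calderon H μ ρ) :=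
  Measurable.lintegral_prod_right' (f := fun p : Rn n × H => ρ (dualAct (p.2 : GL (Fin n) ℝ) p.1))
    (hρ.comp measurable_dualAct_prod)

/-- A property that holds almost everywhere on the frequency space holds along almost every orbit,
at almost every point of the group. Each `h` preserves null sets, so this is Tonelli's theorem. -/
theorem ae_ae_dualAct [SFinite μ] {p : Rn n → Prop} (hp : ∀ᵐ ω, p ω) :
    ∀ᵐ ω : Rn n, ∀ᵐ h : H ∂μ, p (dualAct (h : GL (Fin n) ℝ) ω) := by
  obtain ⟨N, hpN, hN, hN0⟩ := exists_measurable_superset_of_null (ae_iff.1 hp)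
  have hmeas : MeasurableSet {q : Rn n × H | dualAct (q.2 : GL (Fin n) ℝ) q.1 ∉ N} :=
    measurable_dualAct_prod hN.compl
  have h₁ : ∀ᵐ ω : Rn n, ∀ᵐ h : H ∂μ, dualAct (h : GL (Fin n) ℝ) ω ∉ N := by
    refine (Measure.ae_ae_comm (μ := (volume : Measure (Rn n))) (ν := μ)
      (p := fun ω h => dualAct (h : GL (Fin n) ℝ) ω ∉ N) hmeas).2 ?_
    refine Filter.Eventually.of_forall fun h => ?_
    exact (quasiMeasurePreserving_dualAct (h : GL (Fin n) ℝ)).ae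
      (p := fun ω => ω ∉ N) (measure_eq_zero_iff_ae_notMem.1 hN0)
  filter_upwards [h₁] with ω hω
  filter_upwards [hω] with h hh
  by_contra hc
  exact hh (hpN hc)

theorem calderon_congr_ae [SFinite μ] {ρ ρ' : Rn n → ℝ≥0∞} (h : ρ =ᵐ[volume] ρ') :
    calderon H μ ρ =ᵐ[volume] calderon H μ ρ' := by
  filter_upwards [ae_ae_dualAct (μ := μ) h] with ω hω
  exact lintegral_congr_ae hω

/-- For fixed `h`, the wavelet coefficients are, up to conjugation and a constant, a Fourier
integral in the translation variable. This is Parseval's identity for `⟨f, π(x,h) ψ⟩`. -/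
theorem conj_waveletTransform (ψ f : L2 n) (x : Rn n) (h : H) :
    conj (waveletTransform H ψ f (x, h)) = ((|detR (h : GL (Fin n) ℝ)| ^ (1 / 2 : ℝ) : ℝ) : ℂ) *
      𝓕 (fun ω => (𝓕 ψ : L2 n) (dualAct (h : GL (Fin n) ℝ) ω) * conj ((𝓕 f : L2 n) ω)) x := by
  obtain ⟨T, -, hT⟩ := exists_isometry_quasiRegular x (h : GL (Fin n) ℝ)
  have h₁ : waveletTransform H ψ f (x, h) = inner ℂ (T ψ) f := by
    rw [L2.inner_def]
    refine integral_congr_ae ?_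
    filter_upwards [hT ψ] with y hy
    rw [hy]
    rfl
  rw [h₁, ← Lp.inner_fourier_eq, inner_conj_symm, L2.inner_def, Real.fourier_eq,
    ← integral_const_mul]
  refine integral_congr_ae ?_
  filter_upwards [fourier_eq_dualRegular x _ ψ _ (hT ψ)] with ω hω
  rw [hω]
  simp only [dualRegular, RCLike.inner_apply, Circle.smul_def, smul_eq_mul, real_inner_comm x ω]
  ring

theorem memLp_comp_dualAct (h : GL (Fin n) ℝ) (φ : L2 n) :
    MemLp (fun ω => φ (dualAct h ω)) 2 volume := by
  refine MemLp.comp_of_map (f := dualAct h) ?_ (measurable_dualAct h).aemeasurable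
  rw [map_dualAct_volume]
  exact (Lp.memLp φ).smul_measure ENNReal.ofReal_ne_top

theorem measurable_waveletTransform (ψ f : L2 n) : Measurable (waveletTransform H ψ f) := by
  have hψ : Measurable ψ := (Lp.stronglyMeasurable ψ).measurable
  have hf : Measurable f := (Lp.stronglyMeasurable f).measurable
  refine StronglyMeasurable.measurable ?_
  refine StronglyMeasurable.integral_prod_right' (f := fun q : (Rn n × H) × Rn n =>
    f q.2 * (starRingEnd ℂ) (quasiRegular q.1.1 (q.1.2 : GL (Fin n) ℝ) ψ q.2))
    (Measurable.stronglyMeasurable ?_)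
  refine (hf.comp measurable_snd).mul (Complex.continuous_conj.measurable.comp ?_)
  unfold quasiRegular
  have hc : Continuous fun q : (Rn n × H) × Rn n => Matrix.toEuclideanLin
      (((q.1.2 : GL (Fin n) ℝ)⁻¹ : GL (Fin n) ℝ) : Matrix (Fin n) (Fin n) ℝ) (q.2 - q.1.1) := by
    simp only [Matrix.toLpLin_apply]
    refine (PiLp.continuous_toLp 2 _).comp (Continuous.matrix_mulVec ?_ ?_)
    · exact Units.continuous_val.comp
        (continuous_subtype_val.comp (continuous_snd.comp continuous_fst)).inv
    · exact (PiLp.continuous_ofLp 2 _).comp (by fun_prop)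
  have hd : Measurable fun q : (Rn n × H) × Rn n => detR (q.1.2 : GL (Fin n) ℝ) :=
    (continuous_detR.comp
      (continuous_subtype_val.comp (continuous_snd.comp continuous_fst))).measurable
  have hd' : Measurable fun q : (Rn n × H) × Rn n =>
      ((|detR (q.1.2 : GL (Fin n) ℝ)| ^ (-(1 / 2 : ℝ)) : ℝ) : ℂ) :=
    Complex.measurable_ofReal.comp ((continuous_abs.measurable.comp hd).pow_const _)
  exact hd'.mul (hψ.comp hc.measurable)

theorem lintegral_waveletTransform_slice (ψ f : L2 n) (h : H)
    (hG : MemLp (fun ω => (𝓕 ψ : L2 n) (dualAct (h : GL (Fin n) ℝ) ω) * conj ((𝓕 f : L2 n) ω))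
      2 volume) :
    ∫⁻ x, ‖waveletTransform H ψ f (x, h)‖ₑ ^ 2 = ENNReal.ofReal |detR (h : GL (Fin n) ℝ)| *
      ∫⁻ ω, ‖(𝓕 f : L2 n) ω‖ₑ ^ 2 * ‖(𝓕 ψ : L2 n) (dualAct (h : GL (Fin n) ℝ) ω)‖ₑ ^ 2 := by
  have hd : 0 < |detR (h : GL (Fin n) ℝ)| := abs_pos.2 (detR_ne_zero _)
  have hconj : ∀ z : ℂ, ‖conj z‖ₑ = ‖z‖ₑ := fun z => by
    rw [← ofReal_norm, RCLike.norm_conj, ofReal_norm]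
  have hint : Integrable
      (fun ω => (𝓕 ψ : L2 n) (dualAct (h : GL (Fin n) ℝ) ω) * conj ((𝓕 f : L2 n) ω)) :=
    (memLp_comp_dualAct (h : GL (Fin n) ℝ) (𝓕 ψ)).integrable_mul (Lp.memLp (𝓕 f : L2 n)).star
  have h₁ : ∀ x, ‖waveletTransform H ψ f (x, h)‖ₑ ^ 2 =
      ENNReal.ofReal |detR (h : GL (Fin n) ℝ)| * ‖𝓕 (fun ω =>
        (𝓕 ψ : L2 n) (dualAct (h : GL (Fin n) ℝ) ω) * conj ((𝓕 f : L2 n) ω)) x‖ₑ ^ 2 :=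
    fun x => by
      rw [← hconj, conj_waveletTransform, enorm_mul, mul_pow, enorm_rpow_sq_mul hd, Real.rpow_one]
  simp_rw [h₁]
  rw [lintegral_const_mul' _ _ ENNReal.ofReal_ne_top, lintegral_enorm_fourier_sq hint hG]
  congr 1
  refine lintegral_congr fun ω => ?_
  rw [enorm_mul, mul_pow, hconj, mul_comm]

/-- The energy of the wavelet transform is the energy of `𝓕 f` weighted by the Calderón integral of
`|𝓕 ψ|²`. -/
theorem lintegral_waveletTransform [SFinite μ] (ψ f : L2 n)
    (hG : ∀ᵐ h : H ∂μ, MemLp (fun ω => (𝓕 ψ : L2 n) (dualAct (h : GL (Fin n) ℝ) ω) *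
      conj ((𝓕 f : L2 n) ω)) 2 volume) :
    ∫⁻ p, ‖waveletTransform H ψ f p‖ₑ ^ 2 ∂affineHaar H μ =
      ∫⁻ ω, ‖(𝓕 f : L2 n) ω‖ₑ ^ 2 * calderon H μ (fun ω => ‖(𝓕 ψ : L2 n) ω‖ₑ ^ 2) ω := by
  have hψ : Measurable (𝓕 ψ : L2 n) := (Lp.stronglyMeasurable (𝓕 ψ : L2 n)).measurable
  have hf : Measurable (𝓕 f : L2 n) := (Lp.stronglyMeasurable (𝓕 f : L2 n)).measurable
  have hV : Measurable fun p => ‖waveletTransform H ψ f p‖ₑ ^ 2 :=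
    (measurable_waveletTransform ψ f).enorm.pow_const 2
  have hd : Measurable fun h : H => ENNReal.ofReal |detR (h : GL (Fin n) ℝ)|⁻¹ :=
    (((continuous_detR.comp continuous_subtype_val).abs.measurable).inv).ennreal_ofReal
  rw [affineHaar, lintegral_prod_symm _ hV.aemeasurable,
    lintegral_withDensity_eq_lintegral_mul _ hd hV.lintegral_prod_left']
  have h₁ : ∀ᵐ h : H ∂μ, ((fun h : H => ENNReal.ofReal |detR (h : GL (Fin n) ℝ)|⁻¹) *
      fun h => ∫⁻ x, ‖waveletTransform H ψ f (x, h)‖ₑ ^ 2) h =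
      ∫⁻ ω, ‖(𝓕 f : L2 n) ω‖ₑ ^ 2 * ‖(𝓕 ψ : L2 n) (dualAct (h : GL (Fin n) ℝ) ω)‖ₑ ^ 2 := by
    filter_upwards [hG] with h hh
    have hd : 0 < |detR (h : GL (Fin n) ℝ)| := abs_pos.2 (detR_ne_zero _)
    rw [Pi.mul_apply, lintegral_waveletTransform_slice ψ f h hh, ← mul_assoc,
      ← ENNReal.ofReal_mul (by positivity), inv_mul_cancel₀ hd.ne', ENNReal.ofReal_one, one_mul]
  rw [lintegral_congr_ae h₁, lintegral_lintegral_swap]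
  · refine lintegral_congr fun ω => ?_
    rw [calderon, lintegral_const_mul']
    exact ENNReal.pow_ne_top enorm_ne_top
  · refine Measurable.aemeasurable ?_
    exact ((hf.comp measurable_snd).enorm.pow_const 2).mul
      (((hψ.comp measurable_dualAct_prod).comp measurable_swap).enorm.pow_const 2)

theorem enorm_sq_eq_lintegral_fourier (f : L2 n) :
    ‖f‖ₑ ^ 2 = ∫⁻ ω, ‖(𝓕 f : L2 n) ω‖ₑ ^ 2 := by
  rw [← eLpNorm_two_sq, ← Lp.enorm_def, ← ofReal_norm, ← ofReal_norm, Lp.norm_fourier_eq]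

theorem memLp_two_iff {α : Type*} [MeasurableSpace α] {ν : Measure α} {g : α → ℂ}
    (hg : AEStronglyMeasurable g ν) : MemLp g 2 ν ↔ ∫⁻ a, ‖g a‖ₑ ^ 2 ∂ν ≠ ∞ := by
  rw [← eLpNorm_two_sq]
  simp [MemLp, hg, lt_top_iff_ne_top]

/-- A vector whose Calderón integral is `1` almost everywhere is admissible. -/
theorem isAdmissibleVector_of_calderon [SFinite μ] {ψ : L2 n}
    (hψ : ∀ᵐ ω, calderon H μ (fun ω => ‖(𝓕 ψ : L2 n) ω‖ₑ ^ 2) ω = 1) :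
    IsAdmissibleVector H μ ψ := by
  intro f
  have hψm : Measurable (𝓕 ψ : L2 n) := (Lp.stronglyMeasurable (𝓕 ψ : L2 n)).measurable
  have hfm : Measurable (𝓕 f : L2 n) := (Lp.stronglyMeasurable (𝓕 f : L2 n)).measurable
  have hF : Measurable fun p : Rn n × H => ‖(𝓕 f : L2 n) p.1‖ₑ ^ 2 *
      ‖(𝓕 ψ : L2 n) (dualAct (p.2 : GL (Fin n) ℝ) p.1)‖ₑ ^ 2 :=
    ((hfm.comp measurable_fst).enorm.pow_const 2).mul
      ((hψm.comp measurable_dualAct_prod).enorm.pow_const 2)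
  have h₀ : ∫⁻ ω, ‖(𝓕 f : L2 n) ω‖ₑ ^ 2 * calderon H μ (fun ω => ‖(𝓕 ψ : L2 n) ω‖ₑ ^ 2) ω =
      ‖f‖ₑ ^ 2 := by
    rw [enorm_sq_eq_lintegral_fourier]
    refine lintegral_congr_ae ?_
    filter_upwards [hψ] with ω hω
    rw [hω, mul_one]
  have h₁ : ∫⁻ h : H, (∫⁻ ω, ‖(𝓕 f : L2 n) ω‖ₑ ^ 2 *
      ‖(𝓕 ψ : L2 n) (dualAct (h : GL (Fin n) ℝ) ω)‖ₑ ^ 2) ∂μ = ‖f‖ₑ ^ 2 := by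
    have hF' : AEMeasurable (Function.uncurry fun (h : H) ω => ‖(𝓕 f : L2 n) ω‖ₑ ^ 2 *
        ‖(𝓕 ψ : L2 n) (dualAct (h : GL (Fin n) ℝ) ω)‖ₑ ^ 2) (μ.prod volume) :=
      (hF.comp measurable_swap).aemeasurable
    rw [← h₀, lintegral_lintegral_swap hF']
    refine lintegral_congr fun ω => ?_
    rw [calderon, lintegral_const_mul']
    exact ENNReal.pow_ne_top enorm_ne_top
  -- The product is always integrable; it is square integrable for almost every `h` because the
  -- total energy is finite.
  have hG : ∀ᵐ h : H ∂μ, MemLp (fun ω => (𝓕 ψ : L2 n) (dualAct (h : GL (Fin n) ℝ) ω) *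
      conj ((𝓕 f : L2 n) ω)) 2 volume := by
    have h₂ := ae_lt_top (μ := μ) hF.lintegral_prod_left'
      (by rw [h₁]; exact ENNReal.pow_ne_top enorm_ne_top)
    filter_upwards [h₂] with h hh
    rw [memLp_two_iff]
    · refine ne_of_lt (lt_of_eq_of_lt (lintegral_congr fun ω => ?_) hh)
      rw [enorm_mul, mul_pow, mul_comm, ← ofReal_norm (conj _), RCLike.norm_conj, ofReal_norm]
    · exact ((hψm.comp (measurable_dualAct _)).mul
        (Complex.continuous_conj.measurable.comp hfm)).aestronglyMeasurable
  have h₃ := lintegral_waveletTransform ψ f hG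
  rw [h₀] at h₃
  refine ⟨(memLp_two_iff (measurable_waveletTransform ψ f).aestronglyMeasurable).2 ?_, ?_⟩
  · rw [h₃]
    exact ENNReal.pow_ne_top enorm_ne_top
  · rw [← eLpNorm_two_sq] at h₃
    exact (ENNReal.pow_right_strictMono two_ne_zero).injective h₃

/-- The Calderón integral of an admissible vector is `1` almost everywhere: test the isometry on the
functions whose Fourier transform is the indicator of a set of finite measure. -/
theorem IsAdmissibleVector.calderon_eq_one [SFinite μ] {ψ : L2 n}
    (hψ : IsAdmissibleVector H μ ψ) :
    ∀ᵐ ω, calderon H μ (fun ω => ‖(𝓕 ψ : L2 n) ω‖ₑ ^ 2) ω = 1 := by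
  have hψm : Measurable (𝓕 ψ : L2 n) := (Lp.stronglyMeasurable (𝓕 ψ : L2 n)).measurable
  refine ae_eq_of_forall_setLIntegral_eq_of_sigmaFinite
    (measurable_calderon (hψm.enorm.pow_const 2)) measurable_const fun S hS hSfin => ?_
  set F : L2 n := indicatorConstLp 2 hS hSfin.ne 1 with hFdef
  have hF : F =ᵐ[volume] S.indicator fun _ => (1 : ℂ) := indicatorConstLp_coeFn
  set f : L2 n := 𝓕⁻ F with hf
  have hFf : (𝓕 f : L2 n) = F := FourierTransform.fourier_fourierInv_eq F
  have hG : ∀ᵐ h : H ∂μ, MemLp (fun ω => (𝓕 ψ : L2 n) (dualAct (h : GL (Fin n) ℝ) ω) *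
      conj ((𝓕 f : L2 n) ω)) 2 volume := by
    refine Filter.Eventually.of_forall fun h => ?_
    rw [hFf]
    refine (memLp_comp_dualAct (h : GL (Fin n) ℝ) (𝓕 ψ)).mono ?_ ?_
    · exact ((hψm.comp (measurable_dualAct _)).mul (Complex.continuous_conj.measurable.comp
        (Lp.stronglyMeasurable F).measurable)).aestronglyMeasurable
    · filter_upwards [hF] with ω hω
      rw [hω, norm_mul, RCLike.norm_conj]
      refine mul_le_of_le_one_right (norm_nonneg _) ?_
      by_cases h : ω ∈ S <;> simp [h]
  have h₁ := lintegral_waveletTransform ψ f hG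
  rw [← eLpNorm_two_sq, (hψ f).2, enorm_sq_eq_lintegral_fourier, hFf] at h₁
  have h₂ : ∀ u : Rn n → ℝ≥0∞, ∫⁻ ω, ‖F ω‖ₑ ^ 2 * u ω = ∫⁻ ω in S, u ω := fun u => by
    rw [← lintegral_indicator hS]
    refine lintegral_congr_ae ?_
    filter_upwards [hF] with ω hω
    rw [hω]
    by_cases h : ω ∈ S <;> simp [h]
  rw [← h₂, ← h₁, ← h₂]
  simp

/-- Calderón's criterion. Any integrable density `ρ` with Calderón integral `1` is `|𝓕 ψ|²` for some
`ψ` in `L²`, namely the one with `𝓕 ψ = √ρ`. -/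
theorem isAdmissible_iff_calderon [SFinite μ] :
    IsAdmissible H μ ↔ ∃ ρ : Rn n → ℝ≥0∞, Measurable ρ ∧ ∫⁻ ω, ρ ω ≠ ∞ ∧
      ∀ᵐ ω, calderon H μ ρ ω = 1 := by
  constructor
  · rintro ⟨ψ, hψ⟩
    refine ⟨_, (Lp.stronglyMeasurable (𝓕 ψ : L2 n)).measurable.enorm.pow_const 2, ?_,
      hψ.calderon_eq_one⟩
    rw [← enorm_sq_eq_lintegral_fourier]
    exact ENNReal.pow_ne_top enorm_ne_top
  · rintro ⟨ρ, hρm, hρ, hρ1⟩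
    set φ : Rn n → ℂ := fun ω => ((Real.sqrt (ρ ω).toReal : ℝ) : ℂ) with hφ
    have hφm : Measurable φ := Complex.measurable_ofReal.comp hρm.ennreal_toReal.sqrt
    have hφρ : ∀ᵐ ω, ‖φ ω‖ₑ ^ 2 = ρ ω := by
      filter_upwards [ae_lt_top hρm hρ] with ω hω
      rw [hφ, ← ofReal_norm, Complex.norm_real, Real.norm_of_nonneg (Real.sqrt_nonneg _),
        ← ENNReal.ofReal_pow (Real.sqrt_nonneg _), Real.sq_sqrt ENNReal.toReal_nonneg,
        ENNReal.ofReal_toReal hω.ne]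
    have hφL : MemLp φ 2 volume :=
      (memLp_two_iff hφm.aestronglyMeasurable).2 (by rwa [lintegral_congr_ae hφρ])
    refine ⟨𝓕⁻ (hφL.toLp φ), isAdmissibleVector_of_calderon ?_⟩
    rw [FourierTransform.fourier_fourierInv_eq]
    have h₁ : (fun ω => ‖hφL.toLp φ ω‖ₑ ^ 2) =ᵐ[volume] ρ := by
      filter_upwards [hφL.coeFn_toLp, hφρ] with ω h₁ h₂
      rw [h₁, h₂]
    filter_upwards [calderon_congr_ae (μ := μ) h₁, hρ1] with ω h₁ h₂
    rw [h₁, h₂]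

end Calderon

/-! ### Partitioning a Haar measure over a cocompact subgroup -/

section Weight

open scoped ENNReal Pointwise Topology

theorem isMulRightInvariant_of_comm {Λ : Type*} [Group Λ] [MeasurableSpace Λ]
    (hcomm : ∀ a b : Λ, a * b = b * a) (μ : Measure Λ) [μ.IsMulLeftInvariant] :
    μ.IsMulRightInvariant :=
  ⟨fun g => by simp_rw [fun x => hcomm x g]; exact map_mul_left_eq_self μ g⟩

variable {Γ Λ : Type*} [Group Γ] [TopologicalSpace Γ] [IsTopologicalGroup Γ]
  [MeasurableSpace Γ] [BorelSpace Γ] [Group Λ] [TopologicalSpace Λ]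
  [SecondCountableTopology Λ] [MeasurableSpace Λ] [BorelSpace Λ]

/-- For a closed cocompact subgroup `Λ` of a commutative group `Γ` there is a bounded, compactly
supported weight whose integral over every coset of `Λ` is `1`: the indicator of a large compact
set, divided by its integral over the coset. The inverse of `ι l` lets the weight be unfolded by
translations alone, without the inversion invariance of the measure. -/
theorem exists_weight [IsTopologicalGroup Λ] [LocallyCompactSpace Γ] [T2Space Γ]
    (hcomm : ∀ a b : Γ, a * b = b * a) {ι : Λ →* Γ} (hι : Topology.IsClosedEmbedding ι)
    (μ : Measure Λ) [SFinite μ] [μ.IsHaarMeasure] {K : Set Γ} (hK : IsCompact K)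
    (hcover : ∀ x, ∃ k ∈ K, ∃ l, x = k * ι l) :
    ∃ w : Γ → ℝ≥0∞, Measurable w ∧
      (∃ C ≠ ∞, ∃ L, IsCompact L ∧ ∀ x, w x ≤ L.indicator (fun _ => C) x) ∧
      ∀ x, ∫⁻ l, w (x * (ι l)⁻¹) ∂μ = 1 := by
  obtain ⟨V, hV, hV1⟩ := exists_compact_mem_nhds (1 : Γ)
  have : μ.IsMulRightInvariant := isMulRightInvariant_of_comm
    (fun a b => hι.injective (by rw [map_mul, map_mul, hcomm])) μ
  -- The neighbourhood `V` thickens `K`, so that every coset meets `L` in a set of measure at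
  -- least `c`.
  set L : Set Γ := V * K
  have hL : IsCompact L := hV.mul hK
  have hLm : MeasurableSet L := hL.measurableSet
  have hind : Measurable (L.indicator (1 : Γ → ℝ≥0∞)) := measurable_one.indicator hLm
  set W : Γ → ℝ≥0∞ := fun x => ∫⁻ l, L.indicator 1 (x * (ι l)⁻¹) ∂μ with hW
  have hmul : Measurable fun p : Γ × Λ => p.1 * (ι p.2)⁻¹ :=
    (continuous_fst.mul (hι.continuous.comp continuous_snd).inv).measurable
  have hWm : Measurable W := Measurable.lintegral_prod_right'
    (f := fun p : Γ × Λ => L.indicator (1 : Γ → ℝ≥0∞) (p.1 * (ι p.2)⁻¹)) (hind.comp hmul)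
  have hWinv : ∀ x l₀, W (x * ι l₀) = W x := fun x l₀ => by
    rw [hW]
    simp only
    rw [← lintegral_mul_right_eq_self (μ := μ) (fun l => L.indicator 1 (x * ι l₀ * (ι l)⁻¹)) l₀]
    refine lintegral_congr fun l => ?_
    rw [map_mul, _root_.mul_inv_rev, mul_assoc, mul_inv_cancel_left]
  have hmeas : ∀ x, Measurable fun l : Λ => x * (ι l)⁻¹ := fun x =>
    (continuous_const.mul hι.continuous.inv).measurable
  have hWeq : ∀ x, W x = μ {l | x * (ι l)⁻¹ ∈ L} := fun x =>
    lintegral_indicator_one (μ := μ) (s := {l | x * (ι l)⁻¹ ∈ L}) (hmeas x hLm)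
  set c : ℝ≥0∞ := μ {l | (ι l)⁻¹ ∈ V}
  have hc : c ≠ 0 := by
    refine ne_of_gt (lt_of_lt_of_le (IsOpen.measure_pos μ (U := {l | (ι l)⁻¹ ∈ interior V}) ?_ ?_)
      (measure_mono fun l (hl : (ι l)⁻¹ ∈ interior V) => (interior_subset hl : (ι l)⁻¹ ∈ V)))
    · exact isOpen_interior.preimage hι.continuous.inv
    · exact ⟨1, by simpa using mem_interior_iff_mem_nhds.2 hV1⟩
  have hcW : ∀ x, c ≤ W x := fun x => by
    obtain ⟨k, hk, l, rfl⟩ := hcover x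
    rw [hWinv, hWeq]
    refine measure_mono fun l hl => ?_
    change k * (ι l)⁻¹ ∈ L
    rw [hcomm]
    exact Set.mul_mem_mul hl hk
  have hWtop : ∀ x, W x ≠ ∞ := fun x => by
    rw [hWeq]
    refine IsCompact.measure_ne_top ?_
    exact hι.isCompact_preimage
      (((Homeomorph.inv Γ).trans (Homeomorph.mulLeft x)).isCompact_preimage.2 hL)
  have hW0 : ∀ x, W x ≠ 0 := fun x h => hc (le_antisymm (h ▸ hcW x) zero_le)
  refine ⟨fun x => L.indicator 1 x * (W x)⁻¹, hind.mul hWm.inv,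
    ⟨c⁻¹, ENNReal.inv_ne_top.2 hc, L, hL, fun x => ?_⟩, fun x => ?_⟩
  · by_cases hx : x ∈ L
    · simpa [hx] using hcW x
    · simp [hx]
  · have h₁ : ∀ l, W (x * (ι l)⁻¹) = W x := fun l => by rw [← map_inv, hWinv]
    simp_rw [h₁]
    have h₂ : Measurable fun l => L.indicator (1 : Γ → ℝ≥0∞) (x * (ι l)⁻¹) := hind.comp (hmeas x)
    rw [lintegral_mul_const _ h₂]
    exact ENNReal.mul_inv_cancel (hW0 x) (hWtop x)

/-- Integration over `Γ` disintegrates into integration over the cosets of `Λ`, with the weighted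
measure `w dν` in the role of a measure on the quotient. -/
theorem lintegral_eq_lintegral_weight (hcomm : ∀ a b : Γ, a * b = b * a) {ι : Λ →* Γ}
    (hι : Continuous ι) (μ : Measure Λ) [SFinite μ] (ν : Measure Γ) [SFinite ν]
    [ν.IsMulLeftInvariant] {w : Γ → ℝ≥0∞} (hw : Measurable w)
    (hw1 : ∀ x, ∫⁻ l, w (x * (ι l)⁻¹) ∂μ = 1) {F : Γ → ℝ≥0∞} (hF : Measurable F) :
    ∫⁻ x, F x ∂ν = ∫⁻ x, w x * ∫⁻ l, F (x * ι l) ∂μ ∂ν := by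
  have := isMulRightInvariant_of_comm hcomm ν
  have hm₁ : Measurable fun p : Γ × Λ => p.1 * (ι p.2)⁻¹ :=
    (continuous_fst.mul (hι.comp continuous_snd).inv).measurable
  have hm₂ : Measurable fun p : Γ × Λ => p.1 * ι p.2 :=
    (continuous_fst.mul (hι.comp continuous_snd)).measurable
  calc ∫⁻ x, F x ∂ν = ∫⁻ x, ∫⁻ l, F x * w (x * (ι l)⁻¹) ∂μ ∂ν := by
        refine lintegral_congr fun x => ?_
        have hm : Measurable fun l => w (x * (ι l)⁻¹) :=
          hw.comp (hm₁.comp measurable_prodMk_left)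
        rw [lintegral_const_mul _ hm, hw1, mul_one]
    _ = ∫⁻ l, ∫⁻ x, F x * w (x * (ι l)⁻¹) ∂ν ∂μ :=
        lintegral_lintegral_swap ((hF.comp measurable_fst).mul (hw.comp hm₁)).aemeasurable
    _ = ∫⁻ l, ∫⁻ x, w x * F (x * ι l) ∂ν ∂μ := by
        refine lintegral_congr fun l => ?_
        rw [← lintegral_mul_right_eq_self (μ := ν) (fun x => F x * w (x * (ι l)⁻¹)) (ι l)]
        simp_rw [mul_inv_cancel_right, mul_comm]
    _ = ∫⁻ x, ∫⁻ l, w x * F (x * ι l) ∂μ ∂ν :=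
        (lintegral_lintegral_swap
          ((hw.comp measurable_fst).mul (hF.comp hm₂)).aemeasurable).symm
    _ = ∫⁻ x, w x * ∫⁻ l, F (x * ι l) ∂μ ∂ν := by
        refine lintegral_congr fun x => ?_
        have hm : Measurable fun l => F (x * ι l) := hF.comp (hm₂.comp measurable_prodMk_left)
        rw [lintegral_const_mul _ hm]

/-- A compact quotient of a locally compact group is the image of a compact set. -/
theorem exists_compact_mul_eq {Γ : Type*} [Group Γ] [TopologicalSpace Γ] [IsTopologicalGroup Γ]
    [LocallyCompactSpace Γ] (N : Subgroup Γ) [CompactSpace (Γ ⧸ N)] :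
    ∃ K : Set Γ, IsCompact K ∧ ∀ x, ∃ k ∈ K, k⁻¹ * x ∈ N := by
  choose C hC hC' using fun x : Γ => exists_compact_mem_nhds x
  obtain ⟨t, -, ht⟩ := (isCompact_univ (X := Γ ⧸ N)).elim_nhds_subcover
    (fun y => (QuotientGroup.mk : Γ → Γ ⧸ N) '' C y.out) fun y _ => by
      have := QuotientGroup.isOpenMap_coe (N := N) |>.image_mem_nhds (hC' y.out)
      rwa [QuotientGroup.out_eq'] at this
  refine ⟨⋃ y ∈ t, C y.out, t.isCompact_biUnion fun y _ => hC _, fun x => ?_⟩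
  obtain ⟨y, hy, k, hk, hkx⟩ := Set.mem_iUnion₂.1 (ht (Set.mem_univ (x : Γ ⧸ N)))
  exact ⟨k, Set.mem_biUnion hy hk, QuotientGroup.eq.1 hkx⟩

end Weight

/-! ### Averaging Calderón integrals -/

section Averaging

open scoped ENNReal

variable {n : ℕ} {H₀ H₁ : Subgroup (GL (Fin n) ℝ)} {μ₀ : Measure H₀} {μ₁ : Measure H₁}
  [SFinite μ₀] [SFinite μ₁] {w : H₁ → ℝ≥0∞}

/-- The Calderón integral over `H₁` is a weighted average of Calderón integrals over `H₀` along the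
`H₁`-orbit. -/
theorem calderon_eq_lintegral_weight [μ₁.IsMulLeftInvariant]
    (hcomm : ∀ a b : H₁, a * b = b * a) (hle : H₀ ≤ H₁) (hw : Measurable w)
    (hw1 : ∀ x, ∫⁻ l, w (x * (Subgroup.inclusion hle l)⁻¹) ∂μ₀ = 1) {ρ : Rn n → ℝ≥0∞}
    (hρ : Measurable ρ) (ω : Rn n) :
    calderon H₁ μ₁ ρ ω = ∫⁻ x, w x * calderon H₀ μ₀ ρ (dualAct (x : GL (Fin n) ℝ) ω) ∂μ₁ := by
  have hι : Continuous (Subgroup.inclusion hle) := continuous_inclusion hle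
  have hF : Measurable fun x : H₁ => ρ (dualAct (x : GL (Fin n) ℝ) ω) :=
    hρ.comp (measurable_dualAct_comp measurable_id measurable_const)
  rw [calderon, lintegral_eq_lintegral_weight hcomm hι μ₀ μ₁ hw hw1 hF]
  simp only [calderon, Subgroup.coe_mul, dualAct_mul, Subgroup.coe_inclusion]

/-- The Calderón integral over `H₀` of a weighted average of `ρ` is the weighted average of the
Calderón integrals of `ρ`. Commutativity is what allows the two actions to be exchanged. -/
theorem calderon_lintegral_weight (hcomm : ∀ a b : H₁, a * b = b * a) (hle : H₀ ≤ H₁)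
    (hw : Measurable w) {ρ : Rn n → ℝ≥0∞} (hρ : Measurable ρ) (ω : Rn n) :
    calderon H₀ μ₀ (fun ω => ∫⁻ x : H₁, w x * ρ (dualAct (x : GL (Fin n) ℝ) ω) ∂μ₁) ω =
      ∫⁻ x, w x * calderon H₀ μ₀ ρ (dualAct (x : GL (Fin n) ℝ) ω) ∂μ₁ := by
  have hm₁ : Measurable fun p : H₀ × H₁ => dualAct (p.1 : GL (Fin n) ℝ) ω :=
    measurable_dualAct_comp measurable_fst measurable_const
  have hm₂ : Measurable fun p : H₀ × H₁ => dualAct (p.2 : GL (Fin n) ℝ)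
      (dualAct (p.1 : GL (Fin n) ℝ) ω) := measurable_dualAct_comp measurable_snd hm₁
  have hm₃ : Measurable fun p : H₀ × H₁ => w p.2 * ρ (dualAct (p.2 : GL (Fin n) ℝ)
      (dualAct (p.1 : GL (Fin n) ℝ) ω)) := by
    have h₁ : Measurable fun p : H₀ × H₁ => w p.2 := hw.fun_comp measurable_snd
    exact h₁.mul (hρ.fun_comp hm₂)
  have hc : ∀ (h : H₀) (x : H₁), dualAct (x : GL (Fin n) ℝ) (dualAct (h : GL (Fin n) ℝ) ω) =
      dualAct (h : GL (Fin n) ℝ) (dualAct (x : GL (Fin n) ℝ) ω) := fun h x => by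
    have hg : (h : GL (Fin n) ℝ) * x = x * h :=
      congrArg Subtype.val (hcomm (Subgroup.inclusion hle h) x)
    rw [← dualAct_mul, ← dualAct_mul, hg]
  rw [calderon, lintegral_lintegral_swap hm₃.aemeasurable]
  refine lintegral_congr fun x => ?_
  have hm₄ : Measurable fun h : H₀ => dualAct (h : GL (Fin n) ℝ)
      (dualAct (x : GL (Fin n) ℝ) ω) := measurable_dualAct_comp measurable_id measurable_const
  simp_rw [hc]
  rw [calderon, lintegral_const_mul _ (hρ.fun_comp hm₄)]

theorem lintegral_comp_dualAct (h : GL (Fin n) ℝ) {ρ : Rn n → ℝ≥0∞} (hρ : Measurable ρ) :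
    ∫⁻ ω, ρ (dualAct h ω) = ENNReal.ofReal |detR h|⁻¹ * ∫⁻ ω, ρ ω := by
  rw [← lintegral_map hρ (measurable_dualAct h), map_dualAct_volume, lintegral_smul_measure,
    smul_eq_mul]

/-- The weighted average of an integrable density is integrable, as `|det|⁻¹` is bounded on the
compact support of the weight. -/
theorem lintegral_lintegral_weight_ne_top [IsFiniteMeasureOnCompacts μ₁] (hw : Measurable w)
    {C : ℝ≥0∞} (hC : C ≠ ∞) {L : Set H₁} (hL : IsCompact L)
    (hwL : ∀ x, w x ≤ L.indicator (fun _ => C) x) {ρ : Rn n → ℝ≥0∞} (hρ : Measurable ρ)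
    (hρfin : ∫⁻ ω, ρ ω ≠ ∞) :
    ∫⁻ ω : Rn n, (∫⁻ x : H₁, w x * ρ (dualAct (x : GL (Fin n) ℝ) ω) ∂μ₁) ≠ ∞ := by
  have hcont : Continuous fun x : H₁ => |detR (x : GL (Fin n) ℝ)|⁻¹ :=
    (continuous_detR.comp continuous_subtype_val).abs.inv₀ fun x =>
      (abs_pos.2 (detR_ne_zero (x : GL (Fin n) ℝ))).ne'
  obtain ⟨D, hD⟩ := hL.exists_bound_of_continuousOn hcont.continuousOn
  rw [lintegral_lintegral_swap ((hw.comp measurable_snd).mul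
    (hρ.comp measurable_dualAct_prod)).aemeasurable]
  refine ne_top_of_le_ne_top (b := ∫⁻ x, L.indicator
    (fun _ => C * (ENNReal.ofReal D * ∫⁻ ω, ρ ω)) x ∂μ₁) ?_ (lintegral_mono fun x => ?_)
  · rw [lintegral_indicator_const hL.measurableSet]
    exact ENNReal.mul_ne_top (ENNReal.mul_ne_top hC (ENNReal.mul_ne_top ENNReal.ofReal_ne_top
      hρfin)) hL.measure_lt_top.ne
  · have hm : Measurable fun ω => ρ (dualAct (x : GL (Fin n) ℝ) ω) :=
      hρ.comp (measurable_dualAct _)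
    rw [lintegral_const_mul _ hm, lintegral_comp_dualAct _ hρ]
    by_cases hx : x ∈ L
    · have h₁ := hwL x
      have h₂ : |detR (x : GL (Fin n) ℝ)|⁻¹ ≤ D := (le_abs_self _).trans (hD x hx)
      rw [Set.indicator_of_mem hx] at h₁ ⊢
      gcongr
    · have h₁ := hwL x
      rw [Set.indicator_of_notMem hx, nonpos_iff_eq_zero] at h₁
      simp [h₁]

end Averaging

end WaveletAdmissibility

open WaveletAdmissibility in
theorem mainTheorem11 (n : ℕ) (H₀ H₁ : Subgroup (GL (Fin n) ℝ))
    (hclosed₀ : IsClosed (H₀ : Set (GL (Fin n) ℝ)))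
    (hclosed₁ : IsClosed (H₁ : Set (GL (Fin n) ℝ)))
    (hcomm : ∀ a ∈ H₁, ∀ b ∈ H₁, a * b = b * a)
    (hle : H₀ ≤ H₁)
    (hcocompact : CompactSpace (H₁ ⧸ H₀.subgroupOf H₁))
    (μ₀ : MeasureTheory.Measure H₀) (μ₁ : MeasureTheory.Measure H₁)
    (hμ₀ : μ₀.IsHaarMeasure) (hμ₁ : μ₁.IsHaarMeasure) :
    WaveletAdmissibility.IsAdmissible H₀ μ₀ ↔ WaveletAdmissibility.IsAdmissible H₁ μ₁ := by
  have : LocallyCompactSpace (Matrix (Fin n) (Fin n) ℝ) :=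
    inferInstanceAs (LocallyCompactSpace (Fin n → Fin n → ℝ))
  have hc₀ := hclosed₀.isClosedEmbedding_subtypeVal
  have hc₁ := hclosed₁.isClosedEmbedding_subtypeVal
  have : LocallyCompactSpace H₀ := hc₀.locallyCompactSpace
  have : LocallyCompactSpace H₁ := hc₁.locallyCompactSpace
  have hι : Topology.IsClosedEmbedding (Subgroup.inclusion hle) :=
    (Topology.IsClosedEmbedding.of_comp_iff hc₁).1 hc₀
  have hcomm' : ∀ a b : H₁, a * b = b * a := fun a b =>
    Subtype.ext (hcomm a a.2 b b.2)
  obtain ⟨K, hK, hKcover⟩ := exists_compact_mul_eq (H₀.subgroupOf H₁)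
  obtain ⟨w, hw, ⟨C, hC, L, hL, hwL⟩, hw1⟩ := exists_weight hcomm' hι μ₀ hK fun x => by
    obtain ⟨k, hk, hkx⟩ := hKcover x
    refine ⟨k, hk, ⟨_, hkx⟩, Subtype.ext ?_⟩
    simp
  rw [isAdmissible_iff_calderon, isAdmissible_iff_calderon]
  constructor
  · rintro ⟨ρ, hρ, hρfin, hρ1⟩
    -- Over `H₁` the density `ρ` has Calderón integral `c` almost everywhere, so `c⁻¹ ρ` will do.
    set c : ENNReal := ∫⁻ x, w x ∂μ₁ with hcdef
    have hctop : c ≠ ⊤ := by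
      refine ne_top_of_le_ne_top ?_ (lintegral_mono hwL)
      rw [lintegral_indicator_const hL.measurableSet]
      exact ENNReal.mul_ne_top hC hL.measure_lt_top.ne
    have hc0 : c ≠ 0 := fun h => by
      have hw0 := (lintegral_eq_zero_iff hw).1 h
      have h₁ := lintegral_eq_lintegral_weight hcomm' hι.continuous μ₀ μ₁ hw hw1
        (F := fun _ => 1) measurable_const
      have h₂ : ∫⁻ x, w x * ∫⁻ _l : H₀, 1 ∂μ₀ ∂μ₁ = 0 := by
        refine (lintegral_congr_ae ?_).trans lintegral_zero
        filter_upwards [hw0] with x hx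
        rw [hx, Pi.zero_apply, zero_mul]
      rw [h₂, lintegral_one] at h₁
      exact (NeZero.ne μ₁) (Measure.measure_univ_eq_zero.1 h₁)
    refine ⟨fun ω => c⁻¹ * ρ ω, hρ.const_mul _, ?_, ?_⟩
    · rw [lintegral_const_mul _ hρ]
      exact ENNReal.mul_ne_top (ENNReal.inv_ne_top.2 hc0) hρfin
    · filter_upwards [ae_ae_dualAct (μ := μ₁) hρ1] with ω hω
      have h₁ : calderon H₁ μ₁ ρ ω = c := by
        rw [calderon_eq_lintegral_weight hcomm' hle hw hw1 hρ]
        refine lintegral_congr_ae ?_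
        filter_upwards [hω] with x hx
        rw [hx, mul_one]
      rw [calderon, lintegral_const_mul']
      · change c⁻¹ * calderon H₁ μ₁ ρ ω = 1
        rw [h₁, ENNReal.inv_mul_cancel hc0 hctop]
      · exact ENNReal.inv_ne_top.2 hc0
  -- The `H₀`-integral of `ρ` need not be constant, and dividing by it could destroy integrability.
  -- The weighted average of `ρ` has the right `H₀`-integral and stays integrable.
  · rintro ⟨ρ, hρ, hρfin, hρ1⟩
    refine ⟨fun ω => ∫⁻ x : H₁, w x * ρ (dualAct (x : GL (Fin n) ℝ) ω) ∂μ₁, ?_,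
      lintegral_lintegral_weight_ne_top hw hC hL hwL hρ hρfin, ?_⟩
    · exact Measurable.lintegral_prod_right' (f := fun p : Rn n × H₁ =>
        w p.2 * ρ (dualAct (p.2 : GL (Fin n) ℝ) p.1))
        ((hw.comp measurable_snd).mul (hρ.comp measurable_dualAct_prod))
    · filter_upwards [hρ1] with ω hω
      rw [calderon_lintegral_weight hcomm' hle hw hρ,
        ← calderon_eq_lintegral_weight hcomm' hle hw hw1 hρ, hω]
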